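/- Let $k\ge 1$ and $n\ge 2$ be integers, let $\mathbb F_q$ be a finite field with $q$ elements, and let $d=\gcd(k,q-1)$. Call a square matrix over a field $K$ \emph{split semisimple} (diagonalizable) if its minimal polynomial is a product of distinct monic polynomials of degree $1$ in $K[x]$. (1) If $q\ge (d-1)^4+6d$, then $$M_n(\mathbb F_q)=\{A^k+B^k \mid A,B\in M_n(\mathbb F_q)\ \text{split semisimple}\}.$$ (2) In particular, if $q\ge (k-1)^4+6k$, then every matrix in $M_n(\mathbb F_q)$ is of the form $A^k+B^k$ with $A,B\in M_n(\mathbb F_q)$. -/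

import Mathlib

namespace MatrixWaring

open Polynomial in
/-- A square matrix over a field is split semisimple (diagonalizable) if its minimal polynomial
is a product of distinct monic polynomials of degree one. -/
def SplitSemisimple {K : Type*} [Field K] {n : ℕ} (A : Matrix (Fin n) (Fin n) K) : Prop :=
  ∃ S : Finset K, minpoly K A = ∏ a ∈ S, (X - C a)

/-- The set of sums of two `k`-th powers of `n × n` matrices over `K`. -/
def sumsTwoPowers (k n : ℕ) (K : Type*) [Field K] : Set (Matrix (Fin n) (Fin n) K) :=
  {M | ∃ A B : Matrix (Fin n) (Fin n) K, M = A ^ k + B ^ k}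

/-- The set of sums of two `k`-th powers of split semisimple `n × n` matrices over `K`. -/
def sumsTwoPowersSS (k n : ℕ) (K : Type*) [Field K] : Set (Matrix (Fin n) (Fin n) K) :=
  {M | ∃ A B : Matrix (Fin n) (Fin n) K,
    SplitSemisimple A ∧ SplitSemisimple B ∧ M = A ^ k + B ^ k}

end MatrixWaring

/-!
Let `H ≤ Fˣ` be the subgroup of `k`-th powers, of index `d`. Expanding the indicator function of `H`
in the `d` characters that are trivial on it, `d ^ 2` times the number of representations
`c = u + v` with `u, v ∈ H` becomes a sum of `d ^ 2` Jacobi sums. The one for the two trivial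
characters is `q - 2` and the others have absolute value at most `√q`, so for
`q ≥ (d - 1) ^ 4 + 6 * d` there are at least two representations, hence one with `u ≠ 1`.

For matrices, it suffices to write `T` as `A + B` with `A` and `B` diagonalizable and with all
eigenvalues `k`-th powers. On a cyclic block, `T` has a Hessenberg basis with any prescribed
diagonal except for the last entry `c`, which is determined by the trace. Choose the prescribed
entries in `{0, 1, 2}` so that `c ≠ 0`, write `c = α + β` as above with `α ≠ 1`, and distribute the
subdiagonal alternately between `A` and `B`. Apart from the last column of `A`, which carries the
eigenvalue `α ∉ {0, 1}`, both are then block diagonal with blocks of size at most `2`, each with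
distinct eigenvalues.
-/

namespace MatrixWaring

section SumsOfUnits

lemma norm_mulChar_apply_le_one {F : Type*} [Field F] [Finite F] (χ : MulChar F ℂ) (a : F) :
    ‖χ a‖ ≤ 1 := by
  have := Fintype.ofFinite F
  rcases eq_or_ne a 0 with rfl | ha
  · simp [MulChar.map_zero]
  · refine (Complex.norm_eq_one_of_pow_eq_one (n := Fintype.card F - 1) ?_
      (Nat.sub_ne_zero_of_lt Fintype.one_lt_card)).le
    rw [← map_pow, FiniteField.pow_card_sub_one_eq_one a ha, map_one]

variable {F : Type*} [Field F] [Fintype F]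

lemma norm_jacobiSum_of_ne_one {χ ψ : MulChar F ℂ} (hχ : χ ≠ 1) (hψ : ψ ≠ 1) (hχψ : χ * ψ ≠ 1) :
    ‖jacobiSum χ ψ‖ = √(Fintype.card F) := by
  have hchar : ringChar ℂ ≠ ringChar F := by
    rw [ringChar.eq_zero]
    exact (CharP.ringChar_ne_zero_of_finite F).symm
  have hstar : jacobiSum χ⁻¹ ψ⁻¹ = star (jacobiSum χ ψ) := by
    simp only [jacobiSum, star_sum, star_mul', MulChar.star_apply']
  have hnorm := congrArg norm (jacobiSum_mul_jacobiSum_inv hchar hχ hψ hχψ)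
  rw [hstar, norm_mul, norm_star, Complex.norm_natCast] at hnorm
  rw [← hnorm, Real.sqrt_mul_self (norm_nonneg _)]

open scoped Classical in
-- At most one of the three conditions can hold, and each of them replaces the bound `√q` by `1`.
lemma norm_jacobiSum_le {χ ψ : MulChar F ℂ} (h : ¬(χ = 1 ∧ ψ = 1)) :
    ‖jacobiSum χ ψ‖ ≤ √(Fintype.card F) + (if χ = 1 then 1 - √(Fintype.card F) else 0)
      + (if ψ = 1 then 1 - √(Fintype.card F) else 0)
      + (if χ * ψ = 1 then 1 - √(Fintype.card F) else 0) := by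
  by_cases hχ : χ = 1
  · have hψ : ψ ≠ 1 := fun hψ => h ⟨hχ, hψ⟩
    simp [hχ, hψ, jacobiSum_one_nontrivial hψ]
  by_cases hψ : ψ = 1
  · simp [hχ, hψ, jacobiSum_comm χ, jacobiSum_one_nontrivial hχ]
  by_cases hχψ : χ * ψ = 1
  · obtain rfl : ψ = χ⁻¹ := eq_inv_of_mul_eq_one_right hχψ
    simpa [hχ, jacobiSum_nontrivial_inv hχ] using norm_mulChar_apply_le_one χ (-1)
  · simp [hχ, hψ, hχψ, norm_jacobiSum_of_ne_one hχ hψ hχψ]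

lemma sum_mulChar_mul_sub {R : Type*} [CommRing R] (χ ψ : MulChar F R) {c : F} (hc : c ≠ 0) :
    ∑ u, χ u * ψ (c - u) = (χ * ψ) c * jacobiSum χ ψ := by
  rw [jacobiSum, ← Equiv.sum_comp (Equiv.mulLeft₀ c hc), Finset.mul_sum]
  refine Finset.sum_congr rfl fun x _ => ?_
  simp only [Equiv.mulLeft₀_apply, ← mul_one_sub, map_mul, MulChar.mul_apply]
  ring

open scoped Classical in
lemma norm_sum_mul_jacobiSum_sub_le (G : Subgroup (MulChar F ℂ)) [Fintype G] {c : F} (hc : c ≠ 0) :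
    ‖∑ χ : G, ∑ ψ : G, (χ * ψ : MulChar F ℂ) c * jacobiSum (χ : MulChar F ℂ) ψ
        - (Fintype.card F - 2)‖ ≤
      (Nat.card G - 1) * (3 + (Nat.card G - 2) * √(Fintype.card F)) := by
  let bound (χ ψ : G) : ℝ := √(Fintype.card F) + (if χ = 1 then 1 - √(Fintype.card F) else 0)
    + (if ψ = 1 then 1 - √(Fintype.card F) else 0)
    + (if χ * ψ = 1 then 1 - √(Fintype.card F) else 0)
  have hone : (1 * 1 : MulChar F ℂ) c * jacobiSum (1 : MulChar F ℂ) 1 = Fintype.card F - 2 := by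
    rw [mul_one, MulChar.one_apply hc.isUnit, jacobiSum_one_one, one_mul]
  have hterm (p : G × G) (hp : p ≠ 1) :
      ‖(p.1 * p.2 : MulChar F ℂ) c * jacobiSum (p.1 : MulChar F ℂ) p.2‖ ≤ bound p.1 p.2 := by
    refine (norm_mul_le_of_le (norm_mulChar_apply_le_one _ _)
      (norm_jacobiSum_le fun h => hp ?_)).trans_eq ?_
    · exact Prod.ext (Subtype.ext h.1) (Subtype.ext h.2)
    · simp only [bound, one_mul, ← Subgroup.coe_mul, OneMemClass.coe_eq_one]
  have hbound : ∑ χ, ∑ ψ, bound χ ψ =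
      Nat.card G ^ 2 * √(Fintype.card F) + 3 * Nat.card G * (1 - √(Fintype.card F)) := by
    simp only [bound, Finset.sum_add_distrib, mul_eq_one_iff_inv_eq, Finset.sum_ite_eq,
      Finset.sum_ite_eq', Finset.sum_const, Finset.mem_univ, if_true, Finset.card_univ,
      nsmul_eq_mul, Nat.card_eq_fintype_card, ← Finset.mul_sum]
    ring
  rw [← Fintype.sum_prod_type'
    (f := fun χ ψ : G => (χ * ψ : MulChar F ℂ) c * jacobiSum (χ : MulChar F ℂ) ψ),
    ← Finset.add_sum_erase _ _ (Finset.mem_univ (1 : G × G))]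
  simp only [Prod.fst_one, Prod.snd_one, OneMemClass.coe_one, hone, add_sub_cancel_left]
  calc ‖∑ p ∈ Finset.univ.erase (1 : G × G),
        (p.1 * p.2 : MulChar F ℂ) c * jacobiSum (p.1 : MulChar F ℂ) p.2‖
      ≤ ∑ p ∈ Finset.univ.erase (1 : G × G), bound p.1 p.2 :=
        norm_sum_le_of_le _ fun p hp => hterm p (Finset.ne_of_mem_erase hp)
    _ = ∑ χ, ∑ ψ, bound χ ψ - bound 1 1 := by
      rw [Finset.sum_erase_eq_sub (Finset.mem_univ _), Fintype.sum_prod_type]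
      rfl
    _ = (Nat.card G - 1) * (3 + (Nat.card G - 2) * √(Fintype.card F)) := by
      rw [hbound]
      simp only [bound, mul_one, if_true]
      ring

/-- The group of characters that are trivial on `H`. -/
noncomputable def annihilator (H : Subgroup Fˣ) : Subgroup (MulChar F ℂ) :=
  (MulChar.subgroupOrderIsoSubgroupMulChar F ℂ H).ofDual

lemma card_annihilator (H : Subgroup Fˣ) : Nat.card (annihilator H) = H.index :=
  MulChar.card_subgroupOrderIsoSubgroupMulChar

lemma mem_iff_forall_mem_annihilator {H : Subgroup Fˣ} {u : Fˣ} :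
    u ∈ H ↔ ∀ χ ∈ annihilator H, χ u = 1 := by
  rw [← MulChar.mem_subgroupOrderIsoSubgroupMulChar_symm_iff, annihilator, OrderDual.toDual_ofDual,
    OrderIso.symm_apply_apply]

open scoped Classical in
lemma sum_annihilator_apply (H : Subgroup Fˣ) [Fintype (annihilator H)] (a : F) :
    ∑ χ : annihilator H, (χ : MulChar F ℂ) a =
      if a ∈ Units.val '' (H : Set Fˣ) then (H.index : ℂ) else 0 := by
  split_ifs with ha
  · obtain ⟨u, hu, rfl⟩ := ha
    rw [Finset.sum_congr rfl fun (χ : annihilator H) _ => mem_iff_forall_mem_annihilator.1 hu χ χ.2]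
    simp [← card_annihilator]
  rcases eq_or_ne a 0 with rfl | ha0
  · simp [MulChar.map_zero]
  obtain ⟨u, rfl⟩ := ha0.isUnit
  obtain ⟨ψ, hψ, hψu⟩ : ∃ ψ ∈ annihilator H, ψ u ≠ 1 := by
    by_contra! h
    exact ha ⟨u, mem_iff_forall_mem_annihilator.2 h, rfl⟩
  refine eq_zero_of_mul_eq_self_left hψu ?_
  rw [Finset.mul_sum]
  exact Fintype.sum_equiv (Equiv.mulLeft ⟨ψ, hψ⟩) _ _ fun χ => by simp

open scoped Classical in
theorem abs_card_add_representations_sub_le (H : Subgroup Fˣ) {c : F} (hc : c ≠ 0) :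
    |(H.index : ℝ) ^ 2 * Finset.card
        {u | u ∈ Units.val '' (H : Set Fˣ) ∧ c - u ∈ Units.val '' (H : Set Fˣ)}
        - (Fintype.card F - 2)| ≤
      (H.index - 1) * (3 + (H.index - 2) * √(Fintype.card F)) := by
  have := Fintype.ofFinite (annihilator H)
  have hsum : ∑ χ : annihilator H, ∑ ψ : annihilator H,
      (χ * ψ : MulChar F ℂ) c * jacobiSum (χ : MulChar F ℂ) ψ = (H.index : ℂ) ^ 2 * Finset.card
        {u | u ∈ Units.val '' (H : Set Fˣ) ∧ c - u ∈ Units.val '' (H : Set Fˣ)} := by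
    calc _ = ∑ u, (∑ χ : annihilator H, (χ : MulChar F ℂ) u) *
          ∑ ψ : annihilator H, (ψ : MulChar F ℂ) (c - u) := by
            simp only [← sum_mulChar_mul_sub _ _ hc, Finset.sum_mul_sum]
            rw [Finset.sum_comm_cycle]
      _ = _ := by
        simp only [sum_annihilator_apply, ite_zero_mul_ite_zero, ← sq, ← Finset.sum_filter,
          Finset.sum_const, nsmul_eq_mul]
        rw [mul_comm]
  have hle := norm_sum_mul_jacobiSum_sub_le (annihilator H) hc
  rw [hsum, card_annihilator] at hle
  rw [← Real.norm_eq_abs, ← Complex.norm_real]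
  push_cast
  exact hle

lemma sq_add_lt_of_pow_four_le {d q : ℕ} (hq : (d - 1) ^ 4 + 6 * d ≤ q) (hd : 0 < d) :
    (d : ℝ) ^ 2 + (d - 1) * (3 + (d - 2) * √q) < q - 2 := by
  obtain ⟨D, rfl⟩ := Nat.exists_eq_add_one_of_ne_zero hd.ne'
  have hsq : √(q : ℝ) ^ 2 = q := Real.sq_sqrt (Nat.cast_nonneg q)
  have hq' : (D : ℝ) ^ 4 + 6 * (D + 1) ≤ √q ^ 2 := by
    rw [hsq]
    exact_mod_cast hq
  have hlt : (D : ℝ) ^ 2 < √q := by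
    refine lt_of_pow_lt_pow_left₀ 2 (Real.sqrt_nonneg _) ?_
    linarith [pow_mul (D : ℝ) 2 2, Nat.cast_nonneg (α := ℝ) D]
  have hle : (D : ℝ) + 2 ≤ √q := by
    have hpow : (D : ℝ) ^ 2 ≤ D ^ 4 := by
      exact_mod_cast (Nat.le_self_pow two_ne_zero (D ^ 2)).trans_eq (pow_mul D 2 2).symm
    refine le_of_sq_le_sq ?_ (Real.sqrt_nonneg _)
    linarith
  have hpos : 0 < (√q - (D : ℝ) ^ 2) ^ 2 := pow_pos (sub_pos.2 hlt) 2
  have hmul : (D : ℝ) * (D + 2) ≤ D * √q := by gcongr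
  push_cast
  -- The average of `hq'` and `hpos` is `D ^ 2 * √q + 3 * (D + 1) < q`.
  linarith

theorem exists_mem_add_mem_eq (H : Subgroup Fˣ)
    (hq : (H.index - 1) ^ 4 + 6 * H.index ≤ Fintype.card F) {c : F} (hc : c ≠ 0) :
    ∃ u ∈ H, ∃ v ∈ H, u ≠ 1 ∧ (u : F) + v = c := by
  classical
  have hcard : 1 < Finset.card
      {u : F | u ∈ Units.val '' (H : Set Fˣ) ∧ c - u ∈ Units.val '' (H : Set Fˣ)} := by
    by_contra! h
    have hcount := (abs_le.1 (abs_card_add_representations_sub_le H hc)).1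
    have hlt := sq_add_lt_of_pow_four_le hq (Nat.pos_of_ne_zero H.index_ne_zero_of_finite)
    have hle := mul_le_of_le_one_right (sq_nonneg (H.index : ℝ)) (Nat.cast_le_one.2 h)
    linarith
  obtain ⟨_, hmem, hne⟩ := Finset.exists_mem_ne hcard 1
  obtain ⟨⟨u, hu, rfl⟩, v, hv, hvc⟩ := (Finset.mem_filter.1 hmem).2
  exact ⟨u, hu, v, hv, by simpa using hne, by rw [hvc, add_sub_cancel]⟩

theorem exists_pow_add_pow_eq {k : ℕ}
    (hq : (k.gcd (Fintype.card F - 1) - 1) ^ 4 + 6 * k.gcd (Fintype.card F - 1) ≤ Fintype.card F)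
    {c : F} (hc : c ≠ 0) :
    ∃ x y : F, x ≠ 0 ∧ y ≠ 0 ∧ x ^ k ≠ 1 ∧ x ^ k + y ^ k = c := by
  have hindex : (powMonoidHom k : Fˣ →* Fˣ).range.index = k.gcd (Fintype.card F - 1) := by
    rw [IsCyclic.index_powMonoidHom_range, Nat.card_units, Nat.card_eq_fintype_card, Nat.gcd_comm]
  obtain ⟨_, ⟨x, rfl⟩, _, ⟨y, rfl⟩, hx, hxy⟩ :=
    exists_mem_add_mem_eq (powMonoidHom k : Fˣ →* Fˣ).range (hindex ▸ hq) hc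
  exact ⟨x, y, x.ne_zero, y.ne_zero, by simpa [Units.ext_iff] using hx, by simpa using hxy⟩

end SumsOfUnits

section Decomposition

open Module Polynomial

variable {F V : Type*} [Field F] [AddCommGroup V] [Module F V]

/-- The endomorphism `A` is diagonalizable with all its eigenvalues in `S`. -/
def DiagonalizableIn (S : Set F) (A : End F V) : Prop :=
  ⨆ a ∈ S, A.eigenspace a = ⊤

lemma iSup_eigenspace_mono {S S' : Set F} (hS : S ⊆ S') (A : End F V) :
    ⨆ a ∈ S, A.eigenspace a ≤ ⨆ a ∈ S', A.eigenspace a :=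
  biSup_mono hS

lemma DiagonalizableIn.mono {S S' : Set F} (hS : S ⊆ S') {A : End F V}
    (hA : DiagonalizableIn S A) : DiagonalizableIn S' A :=
  top_le_iff.1 (hA.ge.trans (iSup_eigenspace_mono hS A))

lemma DiagonalizableIn.of_basis {ι : Type*} (b : Basis ι F V) {S : Set F} {A : End F V}
    (h : ∀ i, b i ∈ ⨆ a ∈ S, A.eigenspace a) : DiagonalizableIn S A := by
  rw [DiagonalizableIn, ← top_le_iff, ← b.span_eq, Submodule.span_le]
  exact Set.range_subset_iff.2 h

lemma DiagonalizableIn.of_iSup_range_eq_top {ι : Type*} {W : ι → Type*}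
    [∀ i, AddCommGroup (W i)] [∀ i, Module F (W i)] {φ : ∀ i, W i →ₗ[F] V}
    (hφ : ⨆ i, (φ i).range = ⊤) {S : Set F} {A : End F V} {B : ∀ i, End F (W i)}
    (hAB : ∀ i, A ∘ₗ φ i = φ i ∘ₗ B i) (hB : ∀ i, DiagonalizableIn S (B i)) :
    DiagonalizableIn S A := by
  rw [DiagonalizableIn, ← top_le_iff, ← hφ]
  refine iSup_le fun i => ?_
  rw [LinearMap.range_eq_map, ← hB i, Submodule.map_iSup]
  simp only [Submodule.map_iSup]
  refine iSup₂_mono fun a _ => Submodule.map_le_iff_le_comap.2 fun x hx => ?_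
  rw [Submodule.mem_comap, End.mem_eigenspace_iff, ← LinearMap.comp_apply, hAB,
    LinearMap.comp_apply, End.mem_eigenspace_iff.1 hx, map_smul]

lemma mem_iSup_eigenspace_of_apply_eq_smul {S : Set F} {A : End F V} {a : F} (ha : a ∈ S) {v : V}
    (hv : A v = a • v) : v ∈ ⨆ b ∈ S, A.eigenspace b :=
  le_biSup A.eigenspace ha (End.mem_eigenspace_iff.2 hv)

-- `A - a` maps the sum of the eigenspaces for `S` onto itself.
lemma mem_iSup_eigenspace_insert {S : Set F} {A : End F V} {a : F} (ha : a ∉ S) {v : V}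
    (hv : A v - a • v ∈ ⨆ b ∈ S, A.eigenspace b) : v ∈ ⨆ b ∈ insert a S, A.eigenspace b := by
  have hle : ⨆ b ∈ S, A.eigenspace b ≤
      (⨆ b ∈ S, A.eigenspace b).map (A - algebraMap F (End F V) a) := by
    refine iSup₂_le fun b hb x hx => ?_
    have hba : b - a ≠ 0 := sub_ne_zero.2 (ne_of_mem_of_not_mem hb ha)
    have hAx : A x = b • x := End.mem_eigenspace_iff.1 hx
    refine ⟨(b - a)⁻¹ • x, Submodule.smul_mem _ _ (mem_iSup_eigenspace_of_apply_eq_smul hb hAx), ?_⟩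
    rw [map_smul, LinearMap.sub_apply, hAx, Module.algebraMap_end_apply, ← sub_smul,
      inv_smul_smul₀ hba]
  obtain ⟨z, hz, hAz⟩ := hle hv
  have hvz : v - z ∈ A.eigenspace a := by
    rw [End.mem_eigenspace_iff, map_sub, smul_sub, sub_eq_sub_iff_sub_eq_sub, ← hAz,
      LinearMap.sub_apply, Module.algebraMap_end_apply]
  rw [iSup_insert, Submodule.mem_sup]
  exact ⟨v - z, hvz, z, hz, sub_add_cancel v z⟩

lemma mem_iSup_eigenspace_of_pair {S : Set F} {A : End F V} {a b : F} (ha : a ∈ S) (hb : b ∈ S)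
    (hab : a ≠ b) {v w : V} (hv : A v = a • v + w) (hw : A w = b • w) :
    v ∈ ⨆ c ∈ S, A.eigenspace c := by
  have hsub : {a, b} ⊆ S := Set.insert_subset ha (Set.singleton_subset_iff.2 hb)
  refine iSup_eigenspace_mono hsub A (mem_iSup_eigenspace_insert (by simpa using hab) ?_)
  rw [hv, add_sub_cancel_left]
  exact mem_iSup_eigenspace_of_apply_eq_smul (Set.mem_singleton b) hw

/-- The endomorphism `T` is a sum of two diagonalizable endomorphisms with eigenvalues in `S`. -/
def IsSumDiagonalizableIn (S : Set F) (T : End F V) : Prop :=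
  ∃ A B : End F V, T = A + B ∧ DiagonalizableIn S A ∧ DiagonalizableIn S B

lemma IsSumDiagonalizableIn.conj {W : Type*} [AddCommGroup W] [Module F W] {S : Set F}
    {T : End F V} (h : IsSumDiagonalizableIn S T) (e : V ≃ₗ[F] W) :
    IsSumDiagonalizableIn S (e.conj T) := by
  have hconj {A : End F V} (hA : DiagonalizableIn S A) : DiagonalizableIn S (e.conj A) :=
    .of_iSup_range_eq_top (φ := fun _ : Unit => e.toLinearMap) (by simp)
      (fun _ => LinearMap.ext fun v => by simp [LinearEquiv.conj_apply_apply]) fun _ => hA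
  obtain ⟨A, B, rfl, hA, hB⟩ := h
  exact ⟨_, _, map_add _ _ _, hconj hA, hconj hB⟩

lemma IsSumDiagonalizableIn.directSum {ι : Type*} {W : ι → Type*}
    [∀ i, AddCommGroup (W i)] [∀ i, Module F (W i)] {S : Set F} {T : ∀ i, End F (W i)}
    (h : ∀ i, IsSumDiagonalizableIn S (T i)) : IsSumDiagonalizableIn S (DirectSum.lmap T) := by
  classical
  have hlmap {A : ∀ i, End F (W i)} (hA : ∀ i, DiagonalizableIn S (A i)) :
      DiagonalizableIn S (DirectSum.lmap A) :=
    .of_iSup_range_eq_top (φ := DirectSum.lof F ι W) DFinsupp.iSup_range_lsingle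
      (fun i => LinearMap.ext fun v => by simp) hA
  choose A B hAB hA hB using h
  refine ⟨_, _, ?_, hlmap hA, hlmap hB⟩
  ext i x : 2
  simp [hAB]

lemma exists_basis_apply_castSucc_eq {T : End F V} {v : V} {m : ℕ} {b : Basis (Fin (m + 1)) F V}
    (hb : ∀ i, b i = (T ^ (i : ℕ)) v) (d : ℕ → F) :
    ∃ e : Basis (Fin (m + 1)) F V,
      ∀ i : Fin m, T (e i.castSucc) = d i • e i.castSucc + e i.succ := by
  let e : ℕ → V := fun i => i.rec v fun j x => T x - d j • x
  have hTe (i : ℕ) : T (e i) = d i • e i + e (i + 1) := (add_sub_cancel _ _).symm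
  have hpow (j : ℕ) : (T ^ j) v ∈ Submodule.span F (e '' Set.Iic j) := by
    induction j with
    | zero => exact Submodule.subset_span ⟨0, Set.self_mem_Iic, rfl⟩
    | succ j ih =>
      have hmap : (Submodule.span F (e '' Set.Iic j)).map T ≤
          Submodule.span F (e '' Set.Iic (j + 1)) := by
        rw [Submodule.map_span_le]
        rintro _ ⟨i, hi, rfl⟩
        rw [hTe]
        exact add_mem
          (Submodule.smul_mem _ _ (Submodule.subset_span ⟨i, Nat.le_succ_of_le hi, rfl⟩))
          (Submodule.subset_span ⟨i + 1, Nat.succ_le_succ hi, rfl⟩)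
      rw [pow_succ', Module.End.mul_apply]
      exact hmap (Submodule.mem_map_of_mem ih)
  have hspan : ⊤ ≤ Submodule.span F (Set.range fun i : Fin (m + 1) => e i) := by
    rw [← b.span_eq, Submodule.span_le, Set.range_subset_iff]
    refine fun i => hb i ▸ Submodule.span_mono ?_ (hpow i)
    rintro _ ⟨j, hj, rfl⟩
    exact ⟨⟨j, Nat.lt_of_le_of_lt hj i.2⟩, rfl⟩
  refine ⟨basisOfTopLeSpanOfCardEqFinrank _ hspan (finrank_eq_card_basis b).symm, fun i => ?_⟩
  simp only [coe_basisOfTopLeSpanOfCardEqFinrank]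
  exact hTe i

lemma trace_eq_sum_add_of_apply_castSucc {T : End F V} {m : ℕ} {e : Basis (Fin (m + 1)) F V}
    {d : ℕ → F} (he : ∀ i : Fin m, T (e i.castSucc) = d i • e i.castSucc + e i.succ) :
    LinearMap.trace F V T = ∑ i : Fin m, d i + e.repr (T (e (Fin.last m))) (Fin.last m) := by
  rw [LinearMap.trace_eq_matrix_trace F e T, Matrix.trace, Fin.sum_univ_castSucc]
  simp [LinearMap.toMatrix_apply, he, Fin.castSucc_lt_succ.ne']

lemma sub_repr_last_smul_mem_span (T : End F V) {m : ℕ} (e : Basis (Fin (m + 1)) F V) :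
    T (e (Fin.last m)) - e.repr (T (e (Fin.last m))) (Fin.last m) • e (Fin.last m) ∈
      Submodule.span F (Set.range (e ∘ Fin.castSucc)) := by
  have hsum := e.sum_repr (T (e (Fin.last m)))
  rw [Fin.sum_univ_castSucc, ← eq_sub_iff_add_eq] at hsum
  rw [← hsum]
  exact sum_mem fun i _ => Submodule.smul_mem _ _ (Submodule.subset_span ⟨i, rfl⟩)

/-- The diagonal of the first summand, in the basis of `exists_basis_apply_castSucc_eq`, except for
its last entry. The first entry `ε` is free, and serves to change the trace. Parity is counted from
the last index, so that `i + m` is even for `i = m`. -/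
def leftDiag (m : ℕ) (ε : F) (i : ℕ) : F :=
  if i = 0 then ε else if Even (i + m) then 1 else 0

/-- The diagonal of the sum, except for its last entry. -/
def sumDiag (m : ℕ) (ε : F) (i : ℕ) : F :=
  leftDiag m ε i + if Even (i + m) then 1 else 0

lemma leftDiag_mem {ε : F} (hε : ε ∈ ({0, 1} : Set F)) (m i : ℕ) :
    leftDiag m ε i ∈ ({0, 1} : Set F) := by
  unfold leftDiag
  split_ifs <;> simp [hε]

lemma exists_basis_sumDiag_and_repr_last_ne_zero {T : End F V} (hT : T ≠ 0) {v : V} {m : ℕ}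
    {b : Basis (Fin (m + 1)) F V} (hb : ∀ i, b i = (T ^ (i : ℕ)) v) :
    ∃ ε ∈ ({0, 1} : Set F), ∃ e : Basis (Fin (m + 1)) F V,
      (∀ i : Fin m, T (e i.castSucc) = sumDiag m ε i • e i.castSucc + e i.succ) ∧
        e.repr (T (e (Fin.last m))) (Fin.last m) ≠ 0 := by
  cases m with
  | zero =>
    obtain ⟨e, he⟩ := exists_basis_apply_castSucc_eq hb (sumDiag 0 0)
    refine ⟨0, by simp, e, he, fun hc => hT (e.ext fun i => ?_)⟩
    have hmem := sub_repr_last_smul_mem_span T e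
    rw [hc, zero_smul, sub_zero, Set.range_eq_empty, Submodule.span_empty] at hmem
    obtain rfl := Fin.fin_one_eq_zero i
    exact hmem
  | succ n =>
    obtain ⟨ε, hε, hne⟩ : ∃ ε ∈ ({0, 1} : Set F),
        ∑ i : Fin (n + 1), sumDiag (n + 1) ε i ≠ LinearMap.trace F V T := by
      by_contra! h
      have h01 := (h 0 (by simp)).trans (h 1 (by simp)).symm
      simp [Fin.sum_univ_succ, sumDiag, leftDiag] at h01
    obtain ⟨e, he⟩ := exists_basis_apply_castSucc_eq hb (sumDiag (n + 1) ε)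
    refine ⟨ε, hε, e, he, fun hc => hne ?_⟩
    rw [trace_eq_sum_add_of_apply_castSucc he, hc, add_zero]

lemma diagonalizableIn_of_leftDiag {m : ℕ} {e : Basis (Fin (m + 1)) F V} {A : End F V} {ε α : F}
    (hε : ε ∈ ({0, 1} : Set F)) (hα : α ∉ ({0, 1} : Set F))
    (heven : ∀ i : Fin m, Even (i + m : ℕ) → A (e i.castSucc) = e i.castSucc + e i.succ)
    (hodd : ∀ i : Fin m, ¬Even (i + m : ℕ) → A (e i.castSucc) = leftDiag m ε i • e i.castSucc)
    (hlast : A (e (Fin.last m)) - α • e (Fin.last m) ∈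
      Submodule.span F (Set.range (e ∘ Fin.castSucc))) :
    DiagonalizableIn {α, 0, 1} A := by
  have hcast (i : Fin m) : e i.castSucc ∈ ⨆ a ∈ ({0, 1} : Set F), A.eigenspace a := by
    by_cases hi : Even (i + m : ℕ)
    · obtain ⟨j, hj⟩ : ∃ j : Fin m, j.castSucc = i.succ := ⟨⟨i + 1, by grind⟩, rfl⟩
      have hji : (j : ℕ) = i + 1 := congrArg Fin.val hj
      refine mem_iSup_eigenspace_of_pair (a := 1) (b := 0) (by simp) (by simp) one_ne_zero
        (by rw [heven i hi, one_smul]) ?_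
      have hj_odd : ¬Even (j + m : ℕ) := by grind
      rw [← hj, hodd j hj_odd, leftDiag, if_neg (by lia), if_neg hj_odd]
    · exact mem_iSup_eigenspace_of_apply_eq_smul (leftDiag_mem hε m i) (hodd i hi)
  have hspan : Submodule.span F (Set.range (e ∘ Fin.castSucc)) ≤
      ⨆ a ∈ ({0, 1} : Set F), A.eigenspace a :=
    Submodule.span_le.2 (Set.range_subset_iff.2 hcast)
  refine .of_basis e (Fin.lastCases ?_ fun i => ?_)
  · exact mem_iSup_eigenspace_insert hα (hspan hlast)
  · exact iSup_eigenspace_mono (Set.subset_insert α _) A (hcast i)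

lemma diagonalizableIn_of_rightDiag {m : ℕ} {e : Basis (Fin (m + 1)) F V} {B : End F V} {ε β : F}
    (hε : ε ∈ ({0, 1} : Set F)) (hβ : β ≠ 0)
    (heven : ∀ i : Fin m, Even (i + m : ℕ) → B (e i.castSucc) = leftDiag m ε i • e i.castSucc)
    (hodd : ∀ i : Fin m, ¬Even (i + m : ℕ) → B (e i.castSucc) = e i.succ)
    (hlast : B (e (Fin.last m)) = β • e (Fin.last m)) :
    DiagonalizableIn {β, 0, 1} B := by
  refine .of_basis e (Fin.lastCases ?_ fun i => ?_)
  · exact mem_iSup_eigenspace_of_apply_eq_smul (by simp) hlast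
  by_cases hi : Even (i + m : ℕ)
  · exact mem_iSup_eigenspace_of_apply_eq_smul (.inr (leftDiag_mem hε m i)) (heven i hi)
  obtain ⟨b, hb, hb0, hBb⟩ : ∃ b ∈ ({β, 0, 1} : Set F), b ≠ 0 ∧ B (e i.succ) = b • e i.succ := by
    rcases Fin.eq_castSucc_or_eq_last i.succ with ⟨j, hj⟩ | hj
    · have hji : (i : ℕ) + 1 = j := congrArg Fin.val hj
      have hj_even : Even (j + m : ℕ) := by grind
      refine ⟨1, by simp, one_ne_zero, ?_⟩
      rw [hj, heven j hj_even, leftDiag, if_neg (by lia), if_pos hj_even]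
    · exact ⟨β, by simp, hβ, hj ▸ hlast⟩
  exact mem_iSup_eigenspace_of_pair (a := 0) (by simp) hb hb0.symm
    (by rw [hodd i hi, zero_smul, zero_add]) hBb

lemma isSumDiagonalizableIn_of_sumDiag {m : ℕ} {e : Basis (Fin (m + 1)) F V} {T : End F V}
    {ε α β : F} (hε : ε ∈ ({0, 1} : Set F)) (hα : α ∉ ({0, 1} : Set F)) (hβ : β ≠ 0)
    (hT : ∀ i : Fin m, T (e i.castSucc) = sumDiag m ε i • e i.castSucc + e i.succ)
    (hlast : T (e (Fin.last m)) - (α + β) • e (Fin.last m) ∈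
      Submodule.span F (Set.range (e ∘ Fin.castSucc))) :
    IsSumDiagonalizableIn {α, β, 0, 1} T := by
  let A : End F V := e.constr F (Fin.lastCases (T (e (Fin.last m)) - β • e (Fin.last m)) fun i =>
    if Even (i + m : ℕ) then e i.castSucc + e i.succ else leftDiag m ε i • e i.castSucc)
  have hA (i : Fin m) : A (e i.castSucc) =
      if Even (i + m : ℕ) then e i.castSucc + e i.succ else leftDiag m ε i • e i.castSucc := by
    simp only [A, Basis.constr_basis, Fin.lastCases_castSucc]
  have hAlast : A (e (Fin.last m)) = T (e (Fin.last m)) - β • e (Fin.last m) := by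
    simp only [A, Basis.constr_basis, Fin.lastCases_last]
  have hA_diag : DiagonalizableIn {α, 0, 1} A := by
    refine diagonalizableIn_of_leftDiag hε hα (fun i hi => by rw [hA, if_pos hi])
      (fun i hi => by rw [hA, if_neg hi]) ?_
    rwa [hAlast, sub_sub, ← add_smul, add_comm β]
  have hB_diag : DiagonalizableIn {β, 0, 1} (T - A) := by
    refine diagonalizableIn_of_rightDiag (e := e) hε hβ (fun i hi => ?_) (fun i hi => ?_) ?_
    · rw [LinearMap.sub_apply, hT, hA, sumDiag, if_pos hi, if_pos hi]
      module
    · rw [LinearMap.sub_apply, hT, hA, sumDiag, if_neg hi, if_neg hi]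
      module
    · rw [LinearMap.sub_apply, hAlast, sub_sub_cancel]
  exact ⟨A, T - A, (add_sub_cancel _ _).symm, hA_diag.mono (by grind), hB_diag.mono (by grind)⟩

lemma isSumDiagonalizableIn_zero {S : Set F} (h0 : 0 ∈ S) :
    IsSumDiagonalizableIn S (0 : End F V) := by
  have h : DiagonalizableIn S (0 : End F V) := by
    refine top_le_iff.1 fun v _ => mem_iSup_eigenspace_of_apply_eq_smul h0 ?_
    rw [LinearMap.zero_apply, zero_smul]
  exact ⟨0, 0, (add_zero 0).symm, h, h⟩

variable {S : Set F} (h0 : 0 ∈ S) (h1 : 1 ∈ S)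
  (hS : ∀ c : F, c ≠ 0 → ∃ α ∈ S, ∃ β ∈ S, α ≠ 0 ∧ α ≠ 1 ∧ β ≠ 0 ∧ α + β = c)
include h0 h1 hS

lemma isSumDiagonalizableIn_of_cyclic {T : End F V} {v : V} {n : ℕ} {b : Basis (Fin n) F V}
    (hb : ∀ i, b i = (T ^ (i : ℕ)) v) : IsSumDiagonalizableIn S T := by
  rcases eq_or_ne T 0 with rfl | hT
  · exact isSumDiagonalizableIn_zero h0
  cases n with
  | zero => exact absurd (b.ext fun i => i.elim0) hT
  | succ m =>
    obtain ⟨ε, hε, e, he, hc⟩ := exists_basis_sumDiag_and_repr_last_ne_zero hT hb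
    obtain ⟨α, hα, β, hβ, hα0, hα1, hβ0, hαβ⟩ := hS _ hc
    have hlast := sub_repr_last_smul_mem_span T e
    rw [← hαβ] at hlast
    obtain ⟨A, B, hAB, hA, hB⟩ :=
      isSumDiagonalizableIn_of_sumDiag hε (by simp [hα0, hα1]) hβ0 he hlast
    exact ⟨A, B, hAB, hA.mono (by grind), hB.mono (by grind)⟩

lemma isSumDiagonalizableIn_mulLeft_root {f : F[X]} (hf : f ≠ 0) :
    IsSumDiagonalizableIn S (LinearMap.mulLeft F (AdjoinRoot.root f)) :=
  isSumDiagonalizableIn_of_cyclic h0 h1 hS (b := (AdjoinRoot.powerBasis hf).basis) (v := 1)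
    fun i => by simp

theorem isSumDiagonalizableIn_of_finite [Module.Finite F V] (T : End F V) :
    IsSumDiagonalizableIn S T := by
  obtain ⟨ι, _, p, hp, n, ⟨φ⟩⟩ := Module.equiv_directSum_of_isTorsion
    (Module.AEval.isTorsion_of_finiteDimensional F V T)
  let e := (Module.AEval'.of T).trans (φ.restrictScalars F)
  let U (i : ι) : End F (AdjoinRoot (p i ^ n i)) :=
    LinearMap.mulLeft F (AdjoinRoot.root (p i ^ n i))
  have hU : IsSumDiagonalizableIn S (DirectSum.lmap U) := .directSum fun i =>
    isSumDiagonalizableIn_mulLeft_root h0 h1 hS (pow_ne_zero _ (hp i).ne_zero)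
  have hT : T = LinearEquiv.conj e.symm (DirectSum.lmap U) := by
    refine LinearMap.ext fun v => e.eq_symm_apply.2 ?_
    have hφ : φ (Module.AEval'.of T (T v)) = (X : F[X]) • φ (Module.AEval'.of T v) := by
      rw [← Module.AEval'.X_smul_of, map_smul]
    refine hφ.trans (DFinsupp.ext fun i => ?_)
    rw [DirectSum.smul_apply]
    exact Algebra.smul_def (A := F[X] ⧸ Ideal.span {p i ^ n i}) X _
  exact hT ▸ hU.conj e.symm

end Decomposition

section Matrices

open Module Polynomial

variable {F V : Type*} [Field F] [AddCommGroup V] [Module F V]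

lemma DiagonalizableIn.exists_eigenbasis {S : Set F} {A : End F V} (hA : DiagonalizableIn S A) :
    ∃ (s : Set V) (b : Basis s F V), ∀ i, ∃ a ∈ S, A (b i) = a • b i := by
  have hspan : ⊤ ≤ Submodule.span F {v | ∃ a ∈ S, A v = a • v} := by
    rw [← hA]
    exact iSup₂_le fun a ha v hv =>
      Submodule.subset_span ⟨a, ha, End.mem_eigenspace_iff.1 hv⟩
  exact ⟨_, .ofSpan hspan, fun i => Basis.ofSpan_subset hspan ⟨i, rfl⟩⟩

open scoped Classical in
lemma minpoly_eq_prod_of_eigenbasis {ι : Type*} [Fintype ι] (b : Basis ι F V) {A : End F V}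
    {x : ι → F} (hA : ∀ i, A (b i) = x i • b i) :
    minpoly F A = ∏ a ∈ Finset.univ.image x, (X - C a) := by
  have : Module.Finite F V := .of_basis b
  have hmonic : (∏ a ∈ Finset.univ.image x, (X - C a)).Monic := monic_prod_X_sub_C _ _
  refine eq_of_monic_of_associated (minpoly.monic (Algebra.IsIntegral.isIntegral A)) hmonic
    (associated_of_dvd_dvd (minpoly.dvd _ _ (b.ext fun i => ?_)) ?_)
  · rw [End.aeval_apply_of_mem_apply_eq_smul (hA i), eval_prod,
      Finset.prod_eq_zero (Finset.mem_image_of_mem x (Finset.mem_univ i)) (by simp), zero_smul,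
      LinearMap.zero_apply]
  · refine Finset.prod_dvd_of_coprime
      ((pairwise_coprime_X_sub_C Function.injective_id).set_pairwise _) fun a ha => ?_
    obtain ⟨i, -, rfl⟩ := Finset.mem_image.1 ha
    exact dvd_iff_isRoot.2 (End.isRoot_of_hasEigenvalue
      (End.hasEigenvalue_of_hasEigenvector ⟨End.mem_eigenspace_iff.2 (hA i), b.ne_zero i⟩))

lemma DiagonalizableIn.exists_minpoly_eq_prod_and_pow_eq [Module.Finite F V] {k : ℕ} {A : End F V}
    (hA : DiagonalizableIn (Set.range fun x : F => x ^ k) A) :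
    ∃ (B : End F V) (s : Finset F), minpoly F B = ∏ a ∈ s, (X - C a) ∧ B ^ k = A := by
  classical
  obtain ⟨ι, b, hb⟩ := hA.exists_eigenbasis
  have : Fintype ι := FiniteDimensional.fintypeBasisIndex b
  have hroot (i : ι) : ∃ x : F, A (b i) = x ^ k • b i := by
    obtain ⟨_, ⟨x, rfl⟩, hx⟩ := hb i
    exact ⟨x, hx⟩
  choose x hx using hroot
  let B : End F V := b.constr F fun i => x i • b i
  have hB (i : ι) : B (b i) = x i • b i := b.constr_basis F _ i
  refine ⟨B, _, minpoly_eq_prod_of_eigenbasis b hB, b.ext fun i => ?_⟩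
  have hpow := End.aeval_apply_of_mem_apply_eq_smul (p := X ^ k) (hB i)
  rwa [map_pow, aeval_X, eval_pow, eval_X, ← hx] at hpow

theorem sumsTwoPowersSS_eq_univ {k : ℕ} (hk : k ≠ 0)
    (hF : ∀ c : F, c ≠ 0 → ∃ x y : F, x ≠ 0 ∧ y ≠ 0 ∧ x ^ k ≠ 1 ∧ x ^ k + y ^ k = c) (n : ℕ) :
    sumsTwoPowersSS k n F = Set.univ := by
  refine Set.eq_univ_of_forall fun M => ?_
  have hS (c : F) (hc : c ≠ 0) : ∃ α ∈ Set.range fun x : F => x ^ k,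
      ∃ β ∈ Set.range fun x : F => x ^ k, α ≠ 0 ∧ α ≠ 1 ∧ β ≠ 0 ∧ α + β = c := by
    obtain ⟨x, y, hx, hy, hx1, hxy⟩ := hF c hc
    exact ⟨_, ⟨x, rfl⟩, _, ⟨y, rfl⟩, pow_ne_zero k hx, hx1, pow_ne_zero k hy, hxy⟩
  obtain ⟨A, B, hAB, hA, hB⟩ := isSumDiagonalizableIn_of_finite
    (Set.mem_range.2 ⟨0, zero_pow hk⟩) (Set.mem_range.2 ⟨1, one_pow k⟩) hS (Matrix.toLinAlgEquiv' M)
  obtain ⟨A', s, hs, rfl⟩ := hA.exists_minpoly_eq_prod_and_pow_eq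
  obtain ⟨B', t, ht, rfl⟩ := hB.exists_minpoly_eq_prod_and_pow_eq
  refine ⟨Matrix.toLinAlgEquiv'.symm A', Matrix.toLinAlgEquiv'.symm B', ⟨s, ?_⟩, ⟨t, ?_⟩, ?_⟩
  · rw [minpoly.algEquiv_eq, hs]
  · rw [minpoly.algEquiv_eq, ht]
  · rw [← map_pow, ← map_pow, ← map_add, ← hAB, AlgEquiv.symm_apply_apply]

lemma sumsTwoPowersSS_subset_sumsTwoPowers (k n : ℕ) :
    sumsTwoPowersSS k n F ⊆ sumsTwoPowers k n F :=
  fun _ ⟨A, B, _, _, hM⟩ => ⟨A, B, hM⟩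

end Matrices

end MatrixWaring

theorem theorem1p7 (k n : ℕ) (hk : 1 ≤ k) (hn : 2 ≤ n)
    (F : Type*) [Field F] [Fintype F] :
    ((Nat.gcd k (Fintype.card F - 1) - 1) ^ 4 + 6 * Nat.gcd k (Fintype.card F - 1)
        ≤ Fintype.card F →
      MatrixWaring.sumsTwoPowersSS k n F = Set.univ) ∧
    ((k - 1) ^ 4 + 6 * k ≤ Fintype.card F →
      MatrixWaring.sumsTwoPowers k n F = Set.univ) := by
  have hSS (h : (k.gcd (Fintype.card F - 1) - 1) ^ 4 + 6 * k.gcd (Fintype.card F - 1)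
      ≤ Fintype.card F) : MatrixWaring.sumsTwoPowersSS k n F = Set.univ :=
    MatrixWaring.sumsTwoPowersSS_eq_univ (Nat.ne_of_gt hk)
      (fun _ => MatrixWaring.exists_pow_add_pow_eq h) n
  refine ⟨hSS, fun h => Set.univ_subset_iff.1 ?_⟩
  have hgcd : k.gcd (Fintype.card F - 1) ≤ k := Nat.gcd_le_left _ hk
  rw [← hSS (le_trans (by gcongr) h)]
  exact MatrixWaring.sumsTwoPowersSS_subset_sumsTwoPowers k n
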